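/- Let $d\ge 1$ and $\alpha\ge 2$ be integers and set $n=2d+1$. For $(z,t)\in\mathbb{R}^{2d}\times\mathbb{R}=\mathbb{R}^n$ let $$\|(z,t)\|_\alpha=\big(|z|^\alpha+|t|^{\alpha/2}\big)^{1/\alpha},$$ where $|z|$ is the Euclidean norm, and put $$\gamma(\alpha)=\min\Big\{\frac{n-1}{\alpha},\frac12\Big\}\ \text{ if }\alpha\ge 3,\qquad \gamma(\alpha)=\frac{n-2}{2}\ \text{ if }\alpha=2.$$ Then there is a constant $C>0$, depending only on $d$ and $\alpha$, such that for all real $R>1$ and $0\le\delta<1$ the set $$\big\{(m,p)\in\mathbb{Z}^n\times\mathbb{Z}^n:\ \big|\|m\|_\alpha-R\big|\le\delta\ \text{ and }\ \big|\|m-p\|_\alpha-R\big|\le\delta\big\}$$ is finite and has at most $$C\,\max\Big\{R^{\,2\left(n-\frac{\gamma(\alpha)}{n-1-\gamma(\alpha)}\right)},\ (R^n\delta)^2\Big\}$$ elements. -/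

import Mathlib

/-- The Heisenberg gauge `‖(z, t)‖_α = (|z|^α + |t|^(α/2))^(1/α)` on `ℝ^{2d} × ℝ`,
where `|z|` is the Euclidean norm. -/
noncomputable def heisenbergNorm {d : ℕ} (α : ℝ)
    (z : EuclideanSpace ℝ (Fin (2 * d))) (t : ℝ) : ℝ :=
  (‖z‖ ^ α + |t| ^ (α / 2)) ^ (1 / α)

/-- The Heisenberg gauge of a lattice point `m ∈ ℤ^n`, `n = 2d + 1`: the first `2d` coordinates
of `m` form `z` and the last coordinate is `t`. -/
noncomputable def latticeHeisenbergNorm {d : ℕ} (α : ℝ) (m : Fin (2 * d + 1) → ℤ) : ℝ :=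
  heisenbergNorm α (WithLp.toLp 2 fun i : Fin (2 * d) => (m i.castSucc : ℝ))
    (m (Fin.last (2 * d)) : ℝ)

/-- The exponent `γ(α)` in dimension `n`: it is `(n - 2) / 2` if `α = 2` and
`min ((n - 1) / α) (1 / 2)` if `α ≥ 3` (it is only used for `α ≥ 2`). -/
noncomputable def gammaExponent (n α : ℕ) : ℝ :=
  if α = 2 then ((n : ℝ) - 2) / 2 else min (((n : ℝ) - 1) / (α : ℝ)) (1 / 2)

/-- The set of pairs `(m, p) ∈ ℤ^n × ℤ^n`, `n = 2d + 1`, such that both `m` and `m - p`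
(coordinatewise difference) lie within `δ` of the Heisenberg sphere of radius `R`,
as measured by the gauge. -/
def nearSpherePairs (d : ℕ) (α R δ : ℝ) :
    Set ((Fin (2 * d + 1) → ℤ) × (Fin (2 * d + 1) → ℤ)) :=
  {x | |latticeHeisenbergNorm α x.1 - R| ≤ δ ∧ |latticeHeisenbergNorm α (x.1 - x.2) - R| ≤ δ}

/-! The map `(m, p) ↦ (m, m - p)` decouples the two conditions, so the number of pairs is at most
the square of the number of lattice points near one sphere. An elementary slicing count bounds the
latter by a multiple of `R ^ (n - 2/α) + R ^ n * δ`, which suffices because `γ / (n - 1 - γ) ≤ 2 /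
α` (`gammaExponent_div_le`).

The slicing is along the vertical axis. Write `p = 2 / α` and let `z` lie at depth `k ≈ R - |z|`
below radius `R`. The admissible `|t|` fill an interval of length `O(R ^ (2 - p) * k ^ (p - 1) * δ)`
when `k ≥ 2`, and `O(R ^ (2 - p))` near the equator (`card_vertical_fiber_le`). Each unit layer of
depth holds `O(R ^ (n - 2))` integer points `z` (`card_shell_le`). Summing over `k ≤ R` gives `∑ k ^
(p - 1) = O(R ^ p)`, hence the claimed bound (`card_nearSphere_le`). -/

/-! ### Elementary inequalities -/

open Finset in
theorem card_int_le_of_abs_mem_Icc (T : Finset ℤ) {lo hi : ℝ} (h : lo ≤ hi)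
    (hT : ∀ t ∈ T, lo ≤ |(t : ℝ)| ∧ |(t : ℝ)| ≤ hi) : (#T : ℝ) ≤ 2 * (hi - lo) + 2 := by
  classical
  have hsub : T ⊆ Icc ⌈lo⌉ ⌊hi⌋ ∪ (Icc ⌈lo⌉ ⌊hi⌋).image (fun x => -x) := by
    intro t ht
    obtain ⟨h1, h2⟩ := hT t ht
    rw [mem_union, mem_image]
    rcases abs_cases (t : ℝ) with ⟨h3, -⟩ | ⟨h3, -⟩ <;> rw [h3] at h1 h2
    · exact Or.inl (mem_Icc.2 ⟨Int.ceil_le.2 h1, Int.le_floor.2 h2⟩)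
    · exact Or.inr ⟨-t, mem_Icc.2 ⟨Int.ceil_le.2 (by push_cast; exact h1),
        Int.le_floor.2 (by push_cast; exact h2)⟩, neg_neg t⟩
  have hI : (#(Icc ⌈lo⌉ ⌊hi⌋) : ℝ) ≤ hi - lo + 1 := by
    rw [Int.card_Icc]
    rcases le_total 0 (⌊hi⌋ + 1 - ⌈lo⌉) with h0 | h0
    · have : (((⌊hi⌋ + 1 - ⌈lo⌉).toNat : ℤ) : ℝ) = ((⌊hi⌋ + 1 - ⌈lo⌉ : ℤ) : ℝ) := by
        rw [Int.toNat_of_nonneg h0]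
      rw [Int.cast_natCast] at this
      rw [this]
      push_cast
      linarith [Int.floor_le hi, Int.le_ceil lo]
    · rw [Int.toNat_of_nonpos h0]
      push_cast
      linarith
  have h1 : #T ≤ #(Icc ⌈lo⌉ ⌊hi⌋) + #(Icc ⌈lo⌉ ⌊hi⌋) :=
    (card_le_card hsub).trans ((card_union_le _ _).trans (Nat.add_le_add_left card_image_le _))
  have h2 : (#T : ℝ) ≤ #(Icc ⌈lo⌉ ⌊hi⌋) + #(Icc ⌈lo⌉ ⌊hi⌋) := by exact_mod_cast h1
  linarith

/-- Concavity of `x ^ p`, in the form of Bernoulli's inequality at `B / A`. -/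
theorem rpow_sub_rpow_le {A B p : ℝ} (hA : 0 < A) (hAB : A ≤ B) (hp : 0 ≤ p) (hp1 : p ≤ 1) :
    B ^ p - A ^ p ≤ A ^ (p - 1) * (B - A) := by
  have hu : 0 ≤ (B - A) / A := div_nonneg (by linarith) hA.le
  have hB : B = A * (1 + (B - A) / A) := by field_simp; ring
  have h1 : (1 + (B - A) / A) ^ p ≤ 1 + p * ((B - A) / A) :=
    rpow_one_add_le_one_add_mul_self (by linarith) hp hp1
  have h2 : p * ((B - A) / A) ≤ (B - A) / A := mul_le_of_le_one_left hu hp1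
  have h3 : B ^ p = A ^ p * (1 + (B - A) / A) ^ p := by
    conv_lhs => rw [hB]
    exact Real.mul_rpow hA.le (by linarith)
  have h4 : A ^ (p - 1) = A ^ p / A := Real.rpow_sub_one hA.ne' p
  have h5 : A ^ p * (1 + (B - A) / A) ^ p ≤ A ^ p * (1 + (B - A) / A) :=
    mul_le_mul_of_nonneg_left (by linarith) (by positivity)
  rw [h3, h4]
  calc _ ≤ A ^ p * (1 + (B - A) / A) - A ^ p := by linarith
    _ = _ := by ring

/-- Bernoulli at `K / (K + 1)` bounds each term by an increment of `K ^ p / p`, and the increments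
telescope. -/
theorem sum_rpow_sub_one_le {p : ℝ} (hp : 0 < p) (hp1 : p ≤ 1) (K : ℕ) :
    ∑ k ∈ Finset.range K, ((k : ℝ) + 1) ^ (p - 1) ≤ (K : ℝ) ^ p / p := by
  induction K with
  | zero => simp [Real.zero_rpow hp.ne']
  | succ K ih =>
    rw [Finset.sum_range_succ]
    have hK : (0 : ℝ) < (K : ℝ) + 1 := by positivity
    have h1 : (1 + -1 / ((K : ℝ) + 1)) ^ p ≤ 1 + p * (-1 / ((K : ℝ) + 1)) := by
      refine rpow_one_add_le_one_add_mul_self ?_ hp.le hp1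
      rw [le_div_iff₀ hK]
      linarith [K.cast_nonneg (α := ℝ)]
    have h2 : (K : ℝ) = ((K : ℝ) + 1) * (1 + -1 / ((K : ℝ) + 1)) := by field_simp; ring
    have h3 : (K : ℝ) ^ p = ((K : ℝ) + 1) ^ p * (1 + -1 / ((K : ℝ) + 1)) ^ p := by
      conv_lhs => rw [h2]
      refine Real.mul_rpow hK.le ?_
      have : 1 + -1 / ((K : ℝ) + 1) = K / (K + 1) := by field_simp; ring
      rw [this]
      positivity
    have h4 : (K : ℝ) ^ p ≤ ((K : ℝ) + 1) ^ p * (1 + p * (-1 / ((K : ℝ) + 1))) := by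
      rw [h3]
      exact mul_le_mul_of_nonneg_left h1 (by positivity)
    have h5 : ((K : ℝ) + 1) ^ (p - 1) = ((K : ℝ) + 1) ^ p / (K + 1) :=
      Real.rpow_sub_one hK.ne' p
    have h6 : (K : ℝ) ^ p / p ≤ ((K : ℝ) + 1) ^ p / p - ((K : ℝ) + 1) ^ (p - 1) := by
      rw [div_le_iff₀ hp, h5]
      refine h4.trans (le_of_eq ?_)
      field_simp
      ring
    push_cast
    linarith

theorem pow_sub_pow_le_mul {a b : ℝ} (ha : 0 ≤ a) (hab : a ≤ b) (k : ℕ) :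
    b ^ (k + 1) - a ^ (k + 1) ≤ (k + 1) * b ^ k * (b - a) := by
  induction k with
  | zero => simp
  | succ k ih =>
    have h1 : a ^ (k + 1) ≤ b ^ (k + 1) := pow_le_pow_left₀ ha hab _
    have hb : 0 ≤ b := ha.trans hab
    have h2 := mul_le_mul_of_nonneg_left ih hb
    have h3 := mul_le_mul_of_nonneg_right h1 (sub_nonneg.2 hab)
    have h4 : b ^ (k + 1 + 1) - a ^ (k + 1 + 1)
        = b * (b ^ (k + 1) - a ^ (k + 1)) + a ^ (k + 1) * (b - a) := by ring
    have h5 : ((k + 1 : ℕ) + 1 : ℝ) * b ^ (k + 1) * (b - a)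
        = b * ((k + 1) * b ^ k * (b - a)) + b ^ (k + 1) * (b - a) := by push_cast; ring
    rw [h4, h5]
    linarith

theorem mul_pow_le_pow_sub_pow {a b : ℝ} (ha : 0 ≤ a) (hab : a ≤ b) (k : ℕ) :
    b ^ k * (b - a) ≤ b ^ (k + 1) - a ^ (k + 1) := by
  have h := mul_le_mul_of_nonneg_left (pow_le_pow_left₀ ha hab k) ha
  rw [pow_succ, pow_succ]
  nlinarith

/-! ### Integer points in Euclidean shells -/

/-- The Euclidean norm of an integer vector. -/
noncomputable def intVecNorm {N : ℕ} (z : Fin N → ℤ) : ℝ :=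
  ‖WithLp.toLp 2 fun i : Fin N => (z i : ℝ)‖

theorem intVecNorm_nonneg {N : ℕ} (z : Fin N → ℤ) : 0 ≤ intVecNorm z := norm_nonneg _

theorem intVecNorm_sq {N : ℕ} (z : Fin N → ℤ) : intVecNorm z ^ 2 = ∑ i, (z i : ℝ) ^ 2 := by
  simp [intVecNorm, EuclideanSpace.norm_sq_eq]

theorem abs_coord_le_intVecNorm {N : ℕ} (z : Fin N → ℤ) (i : Fin N) :
    |(z i : ℝ)| ≤ intVecNorm z := by
  refine abs_le_of_sq_le_sq ?_ (intVecNorm_nonneg z)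
  rw [intVecNorm_sq]
  exact Finset.single_le_sum (f := fun i => (z i : ℝ) ^ 2) (fun i _ => sq_nonneg _)
    (Finset.mem_univ i)

theorem intVecNorm_le_mul_abs_coord {N : ℕ} (z : Fin N → ℤ) (i : Fin N)
    (hi : ∀ j, |z j| ≤ |z i|) : intVecNorm z ≤ N * |(z i : ℝ)| := by
  have hN : (1 : ℝ) ≤ N := by exact_mod_cast (Fin.pos i)
  refine abs_le_of_sq_le_sq' ?_ (by positivity) |>.2
  rw [intVecNorm_sq]
  calc ∑ j, (z j : ℝ) ^ 2 ≤ ∑ _j : Fin N, (z i : ℝ) ^ 2 :=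
        Finset.sum_le_sum fun j _ => sq_le_sq.2 (by exact_mod_cast hi j)
    _ = N * (z i : ℝ) ^ 2 := by simp
    _ ≤ (N * N) * (z i : ℝ) ^ 2 := by gcongr; nlinarith
    _ = _ := by rw [mul_pow, sq_abs]; ring

/-- When only coordinate `i` varies, its square changes by at most `(r + 2) ^ 2 - r ^ 2 = O(r)`
upwards. Since `i` is a dominant coordinate of `z`, `|z i| ≥ r / N`, so `|z i|` itself changes by
`O(N)`. -/
theorem abs_coord_le_add_of_update_eq {N : ℕ} {z z' : Fin N → ℤ} {i : Fin N} {r : ℝ}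
    (hz : r ≤ intVecNorm z) (hz' : intVecNorm z' ≤ r + 2)
    (hi : ∀ j, |z j| ≤ |z i|) (h : Function.update z i 0 = Function.update z' i 0) :
    |(z' i : ℝ)| ≤ |(z i : ℝ)| + 8 * N := by
  have hN : (1 : ℝ) ≤ N := by exact_mod_cast (Fin.pos i)
  by_cases hr : r < 1
  · linarith [abs_coord_le_intVecNorm z' i, abs_nonneg (z i : ℝ)]
  push Not at hr
  have hdiff : (z' i : ℝ) ^ 2 - (z i : ℝ) ^ 2 = intVecNorm z' ^ 2 - intVecNorm z ^ 2 := by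
    rw [intVecNorm_sq, intVecNorm_sq, ← Finset.add_sum_erase _ _ (Finset.mem_univ i),
      ← Finset.add_sum_erase (a := i) _ (fun i => (z i : ℝ) ^ 2) (Finset.mem_univ i)]
    have : ∑ j ∈ Finset.univ.erase i, (z' j : ℝ) ^ 2
        = ∑ j ∈ Finset.univ.erase i, (z j : ℝ) ^ 2 := by
      refine Finset.sum_congr rfl fun j hj => ?_
      have := congrFun h j
      rw [Function.update_of_ne (Finset.ne_of_mem_erase hj),
        Function.update_of_ne (Finset.ne_of_mem_erase hj)] at this
      rw [this]
    rw [this]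
    ring
  have h1 : intVecNorm z' ^ 2 ≤ (r + 2) ^ 2 := pow_le_pow_left₀ (intVecNorm_nonneg _) hz' 2
  have h2 : r ^ 2 ≤ intVecNorm z ^ 2 := pow_le_pow_left₀ (by linarith) hz 2
  have h3 : r ≤ N * |(z i : ℝ)| := hz.trans (intVecNorm_le_mul_abs_coord z i hi)
  rw [← sq_abs (z' i : ℝ), ← sq_abs (z i : ℝ)] at hdiff
  by_contra! hc
  have h4 : 0 ≤ |(z i : ℝ)| := abs_nonneg _
  have h5 : (|(z i : ℝ)| + 8 * N) ^ 2 < |(z' i : ℝ)| ^ 2 := pow_lt_pow_left₀ hc (by positivity) two_ne_zero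
  nlinarith

-- Split the points by the index `i` of a largest coordinate. The other `N` coordinates take `O(R)`
-- values each, and they determine coordinate `i` up to boundedly many choices.
open Finset in
theorem card_shell_le {N : ℕ} {R r : ℝ} (hR : 1 < R) (hr : r ≤ R) (S : Finset (Fin (N + 1) → ℤ))
    (hS : ∀ z ∈ S, r ≤ intVecNorm z ∧ intVecNorm z ≤ r + 2) :
    (#S : ℝ) ≤ ((N + 1) * (32 * (N + 1) + 2) * 7 ^ N) * R ^ N := by
  classical
  -- Coordinates are at most `r + 2 ≤ R + 2 ≤ 3 * R`.
  set L : ℤ := ⌊3 * R⌋ with hL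
  have hL0 : 0 ≤ L := Int.floor_nonneg.2 (by linarith)
  have hfib : ∀ i, (#{z ∈ S | ∀ j, |z j| ≤ |z i|}) ≤ (32 * (N + 1) + 2) * (2 * L.toNat + 1) ^ N := by
    intro i
    set Si := {z ∈ S | ∀ j, |z j| ≤ |z i|} with hSi
    have h1 : #Si ≤ (32 * (N + 1) + 2) * #(Si.image fun z => Function.update z i 0) := by
      refine card_le_mul_card_image _ _ fun b hb => ?_
      obtain ⟨z₀, hz₀, rfl⟩ := mem_image.1 hb
      set G := {z ∈ Si | Function.update z i 0 = Function.update z₀ i 0} with hG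
      have hinj : Set.InjOn (fun z : Fin (N + 1) → ℤ => z i) G := by
        intro z hz z' hz' hzz
        have e1 := (mem_filter.1 hz).2
        have e2 := (mem_filter.1 hz').2
        have e3 := e1.trans e2.symm
        rw [← Function.update_eq_self i z, ← Function.update_eq_self i z']
        have := congrArg (fun v => Function.update v i (z i)) e3
        simp only [Function.update_idem] at this
        simp only at hzz
        rw [this, hzz]
      rw [← card_image_of_injOn hinj]
      have h2 := card_int_le_of_abs_mem_Icc (G.image fun z => z i)
        (lo := |(z₀ i : ℝ)| - 8 * (N + 1)) (hi := |(z₀ i : ℝ)| + 8 * (N + 1))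
        (by linarith [N.cast_nonneg (α := ℝ)]) (by
          intro t ht
          obtain ⟨z, hz, rfl⟩ := mem_image.1 ht
          obtain ⟨hz1, hz2⟩ := mem_filter.1 hz
          obtain ⟨hz3, hz4⟩ := mem_filter.1 hz1
          obtain ⟨hz5, hz6⟩ := mem_filter.1 hz₀
          have k1 := abs_coord_le_add_of_update_eq (hS _ hz3).1 (hS _ hz5).2 hz4 hz2
          have k2 := abs_coord_le_add_of_update_eq (hS _ hz5).1 (hS _ hz3).2 hz6 hz2.symm
          push_cast at k1 k2
          constructor <;> linarith)
      have h3 : (#(G.image fun z => z i) : ℝ) ≤ ((32 * (N + 1) + 2 : ℕ) : ℝ) := by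
        push_cast
        linarith
      exact_mod_cast h3
    refine h1.trans (Nat.mul_le_mul_left _ ?_)
    have h4 : (Si.image fun z => Function.update z i 0) ⊆
        Fintype.piFinset fun j => if j = i then {0} else Icc (-L) L := by
      intro b hb
      obtain ⟨z, hz, rfl⟩ := mem_image.1 hb
      rw [Fintype.mem_piFinset]
      intro j
      by_cases hj : j = i
      · subst hj
        simp
      · rw [Function.update_of_ne hj, if_neg hj, mem_Icc, ← abs_le, hL, Int.le_floor]
        push_cast
        have := (hS z (mem_filter.1 hz).1).2
        linarith [abs_coord_le_intVecNorm z j]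
    refine (card_le_card h4).trans (le_of_eq ?_)
    rw [Fintype.card_piFinset, ← mul_prod_erase _ _ (mem_univ i)]
    have : ∀ j ∈ univ.erase i, #(if j = i then {0} else Icc (-L) L) = 2 * L.toNat + 1 := by
      intro j hj
      rw [if_neg (ne_of_mem_erase hj), Int.card_Icc]
      omega
    rw [prod_congr rfl this]
    simp
  have hcov : S ⊆ univ.biUnion fun i => {z ∈ S | ∀ j, |z j| ≤ |z i|} := by
    intro z hz
    obtain ⟨i, -, hi⟩ := exists_max_image univ (fun j => |z j|) univ_nonempty
    exact mem_biUnion.2 ⟨i, mem_univ i, mem_filter.2 ⟨hz, fun j => hi j (mem_univ j)⟩⟩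
  have h5 : #S ≤ (N + 1) * ((32 * (N + 1) + 2) * (2 * L.toNat + 1) ^ N) := by
    refine (card_le_card hcov).trans ((card_biUnion_le_card_mul _ _ _ fun i _ => hfib i).trans ?_)
    simp
  have h6 : (2 * (L.toNat : ℝ) + 1) ≤ 7 * R := by
    have : ((L.toNat : ℤ) : ℝ) = (L : ℝ) := by rw [Int.toNat_of_nonneg hL0]
    rw [Int.cast_natCast] at this
    rw [this]
    linarith [Int.floor_le (3 * R)]
  calc (#S : ℝ) ≤ (N + 1) * ((32 * (N + 1) + 2) * (2 * (L.toNat : ℝ) + 1) ^ N) := by exact_mod_cast h5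
    _ ≤ (N + 1) * ((32 * (N + 1) + 2) * (7 * R) ^ N) := by gcongr
    _ = _ := by rw [mul_pow]; ring

/-! ### Vertical fibres and their sum over shells -/

/-- The weight of the `k`-th unit shell below radius `R`. -/
noncomputable def shellWeight (p δ : ℝ) (k : ℕ) : ℝ := if k ≤ 1 then 1 else (k : ℝ) ^ (p - 1) * δ

theorem sum_shellWeight_le {p δ : ℝ} (hp : 0 < p) (hp1 : p ≤ 1) (hδ : 0 ≤ δ) (K : ℕ) :
    ∑ k ∈ Finset.range (K + 1), shellWeight p δ k ≤ 2 + (K : ℝ) ^ p / p * δ := by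
  rw [Finset.sum_range_succ']
  have h0 : shellWeight p δ 0 = 1 := by simp [shellWeight]
  have h1 : ∑ k ∈ Finset.range K, shellWeight p δ (k + 1)
      ≤ ∑ k ∈ Finset.range K, (((k : ℝ) + 1) ^ (p - 1) * δ + if k = 0 then 1 else 0) := by
    refine Finset.sum_le_sum fun k _ => ?_
    unfold shellWeight
    by_cases hk : k = 0
    · subst hk
      simp [hδ]
    · rw [if_neg (by omega), if_neg hk]
      push_cast
      simp
  rw [Finset.sum_add_distrib, ← Finset.sum_mul] at h1
  have h2 := mul_le_mul_of_nonneg_right (sum_rpow_sub_one_le hp hp1 K) hδ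
  have h3 : ∑ k ∈ Finset.range K, (if k = 0 then (1 : ℝ) else 0) ≤ 1 := by
    rw [Finset.sum_ite_eq']
    split_ifs <;> norm_num
  linarith

open Finset in
theorem card_vertical_fiber_le {β : ℕ} (hβ : 1 ≤ β) {R δ a : ℝ} (hR : 1 < R) (hδ : 0 ≤ δ)
    (hδ1 : δ < 1) (ha : 0 ≤ a) (T : Finset ℤ)
    (hT : ∀ t ∈ T, (R - δ) ^ (β + 1) ≤ a ^ (β + 1) + |(t : ℝ)| ^ (((β + 1 : ℕ) : ℝ) / 2) ∧
      a ^ (β + 1) + |(t : ℝ)| ^ (((β + 1 : ℕ) : ℝ) / 2) ≤ (R + δ) ^ (β + 1)) :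
    (#T : ℝ) ≤ 2 + 6 * (β + 1) * 8 ^ (β + 1) * R ^ (2 - 2 / ((β + 1 : ℕ) : ℝ)) *
      shellWeight (2 / ((β + 1 : ℕ) : ℝ)) δ ⌊R - a⌋₊ := by
  have hβ' : (1 : ℝ) ≤ β := by exact_mod_cast hβ
  set q : ℝ := ((β + 1 : ℕ) : ℝ) with hq
  have hq' : q = β + 1 := by rw [hq]; push_cast; rfl
  set p : ℝ := 2 / q with hp
  have hq0 : 0 < q := by linarith
  have hp0 : 0 < p := by positivity
  have hp1 : p ≤ 1 := by rw [hp, div_le_one hq0]; linarith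
  have hR0 : 0 < R := by linarith
  -- Source of the exponent `2 - p`: it turns `(R ^ β) ^ p` into `R ^ (2 - p)`.
  have hexp : (β : ℝ) * p = 2 - p := by rw [hp]; field_simp; linarith
  have habs : ∀ t : ℤ, (|(t : ℝ)| ^ (q / 2)) ^ p = |(t : ℝ)| := by
    intro t
    rw [← Real.rpow_mul (abs_nonneg _), hp]
    have : q / 2 * (2 / q) = 1 := by field_simp
    rw [this, Real.rpow_one]
  rcases T.eq_empty_or_nonempty with rfl | ⟨t₀, ht₀⟩
  · have : 0 ≤ shellWeight p δ ⌊R - a⌋₊ := by unfold shellWeight; split_ifs <;> positivity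
    simp only [card_empty, Nat.cast_zero]
    positivity
  set B := (R + δ) ^ (β + 1) - a ^ (β + 1) with hB
  have hs0 : ∀ t : ℤ, 0 ≤ |(t : ℝ)| ^ (q / 2) := fun t => by positivity
  have hB0 : 0 ≤ B := by linarith [(hT t₀ ht₀).2, hs0 t₀]
  have haR : a ≤ R + δ := le_of_pow_le_pow_left₀ (Nat.succ_ne_zero β) (by linarith) (sub_nonneg.1 hB0)
  have hhi : ∀ t ∈ T, |(t : ℝ)| ≤ B ^ p := by
    intro t ht
    rw [← habs t]
    exact Real.rpow_le_rpow (hs0 t) (by linarith [(hT t ht).2]) hp0.le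
  have hpowR : (R ^ β) ^ p = R ^ (2 - p) := by
    rw [← hexp, Real.rpow_mul hR0.le, Real.rpow_natCast]
  have h2R : (R + δ) ^ β ≤ 2 ^ β * R ^ β := by
    rw [← mul_pow]
    exact pow_le_pow_left₀ (by linarith) (by linarith) _
  have h28 : (2 : ℝ) ^ β ≤ 8 ^ (β + 1) := by
    calc (2 : ℝ) ^ β ≤ 8 ^ β := pow_le_pow_left₀ (by norm_num) (by norm_num) _
      _ ≤ _ := pow_le_pow_right₀ (by norm_num) (Nat.le_succ _)
  unfold shellWeight
  split_ifs with hk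
  -- Near the equator the lower endpoint may degenerate, so only `|t| ≤ B ^ p` is used.
  · have hka : R - a < 2 := by
      have := Nat.lt_floor_add_one (R - a)
      have h : (⌊R - a⌋₊ : ℝ) ≤ 1 := by exact_mod_cast hk
      linarith
    have h1 : B ≤ (3 * (β + 1) * 8 ^ (β + 1)) * R ^ β := by
      calc B ≤ (β + 1) * (R + δ) ^ β * (R + δ - a) := pow_sub_pow_le_mul ha haR β
        _ ≤ (β + 1) * (8 ^ (β + 1) * R ^ β) * 3 := by
          gcongr
          · exact h2R.trans (by gcongr)
          · linarith
        _ = _ := by ring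
    have hc : (1 : ℝ) ≤ 3 * (β + 1) * 8 ^ (β + 1) :=
      one_le_mul_of_one_le_of_one_le (by linarith) (one_le_pow₀ (by norm_num))
    have h2 : B ^ p ≤ (3 * (β + 1) * 8 ^ (β + 1)) * R ^ (2 - p) := by
      calc B ^ p ≤ ((3 * (β + 1) * 8 ^ (β + 1)) * R ^ β) ^ p := Real.rpow_le_rpow hB0 h1 hp0.le
        _ = (3 * (β + 1) * 8 ^ (β + 1)) ^ p * R ^ (2 - p) := by
          rw [Real.mul_rpow (by positivity) (by positivity), hpowR]
        _ ≤ _ := by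
          gcongr
          exact (Real.rpow_le_rpow_of_exponent_le hc hp1).trans (Real.rpow_one _).le
    have h3 := card_int_le_of_abs_mem_Icc T (lo := 0) (hi := B ^ p) (by positivity)
      fun t ht => ⟨abs_nonneg _, hhi t ht⟩
    linarith
  · push Not at hk
    set k := ⌊R - a⌋₊ with hkdef
    have hk2 : (2 : ℝ) ≤ k := by exact_mod_cast hk
    have hka : (k : ℝ) ≤ R - a := by
      refine Nat.floor_le ?_
      by_contra! h
      rw [Nat.floor_of_nonpos h.le] at hkdef
      omega
    set A := (R - δ) ^ (β + 1) - a ^ (β + 1) with hA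
    -- As `k ≥ 2` and `δ < 1`, both `R - δ ≥ R / 4` and `R - δ - a ≥ k / 4` hold, which keeps `A`
    -- away from zero.
    set A₀ := R ^ β * k / 4 ^ (β + 1) with hA₀
    have hA₀0 : 0 < A₀ := by positivity
    have hA₀A : A₀ ≤ A := by
      calc A₀ = (R / 4) ^ β * (k / 4) := by rw [hA₀, div_pow, pow_succ]; field_simp
        _ ≤ (R - δ) ^ β * (R - δ - a) := by
          have : 0 ≤ R - δ - a := by linarith
          exact mul_le_mul (pow_le_pow_left₀ (by linarith) (by linarith) _) (by linarith)
            (by linarith) (pow_nonneg (by linarith) _)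
        _ ≤ A := mul_pow_le_pow_sub_pow ha (by linarith) β
    have hA0 : 0 < A := hA₀0.trans_le hA₀A
    have hBA : B - A ≤ 2 * (β + 1) * (2 ^ β * R ^ β) * δ := by
      calc B - A = (R + δ) ^ (β + 1) - (R - δ) ^ (β + 1) := by rw [hB, hA]; ring
        _ ≤ (β + 1) * (R + δ) ^ β * (R + δ - (R - δ)) :=
          pow_sub_pow_le_mul (by linarith) (by linarith) β
        _ ≤ (β + 1) * (2 ^ β * R ^ β) * (R + δ - (R - δ)) := by
          gcongr
          linarith
        _ = _ := by ring
    have hAB : A ≤ B := by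
      have : (R - δ) ^ (β + 1) ≤ (R + δ) ^ (β + 1) :=
        pow_le_pow_left₀ (by linarith) (by linarith) _
      linarith
    have h1 : A ^ (p - 1) ≤ A₀ ^ (p - 1) :=
      Real.rpow_le_rpow_of_nonpos hA₀0 hA₀A (by linarith)
    have h2 : A₀ ^ (p - 1) ≤ (R ^ β) ^ (p - 1) * k ^ (p - 1) * 4 ^ (β + 1) := by
      rw [hA₀, Real.div_rpow (by positivity) (by positivity),
        Real.mul_rpow (by positivity) (by positivity), div_eq_mul_inv, ← Real.rpow_neg (by positivity)]
      gcongr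
      refine (Real.rpow_le_rpow_of_exponent_le (one_le_pow₀ (by norm_num))
        (by linarith : -(p - 1) ≤ 1)).trans (Real.rpow_one _).le
    have h3 : (R ^ β) ^ (p - 1) * R ^ β = R ^ (2 - p) := by
      rw [Real.rpow_sub_one (by positivity), hpowR]
      field_simp
    have h4 : B ^ p - A ^ p ≤
        2 * (β + 1) * (4 ^ (β + 1) * 2 ^ β) * R ^ (2 - p) * (k ^ (p - 1) * δ) := by
      calc B ^ p - A ^ p ≤ A ^ (p - 1) * (B - A) := rpow_sub_rpow_le hA0 hAB hp0.le hp1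
        _ ≤ ((R ^ β) ^ (p - 1) * k ^ (p - 1) * 4 ^ (β + 1)) *
            (2 * (β + 1) * (2 ^ β * R ^ β) * δ) :=
          mul_le_mul (h1.trans h2) hBA (by linarith) (by positivity)
        _ = 2 * (β + 1) * (4 ^ (β + 1) * 2 ^ β) * ((R ^ β) ^ (p - 1) * R ^ β) *
            (k ^ (p - 1) * δ) := by ring
        _ = _ := by rw [h3]
    have h5 := card_int_le_of_abs_mem_Icc T (lo := A ^ p) (hi := B ^ p)
      (Real.rpow_le_rpow hA0.le hAB hp0.le) fun t ht => ⟨by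
        rw [← habs t]
        exact Real.rpow_le_rpow hA0.le (by linarith [(hT t ht).1]) hp0.le, hhi t ht⟩
    have h6 : (4 : ℝ) ^ (β + 1) * 2 ^ β ≤ 8 ^ (β + 1) := by
      calc (4 : ℝ) ^ (β + 1) * 2 ^ β ≤ 4 ^ (β + 1) * 2 ^ (β + 1) := by
            gcongr
            · norm_num
            · exact Nat.le_succ β
        _ = _ := by rw [← mul_pow]; norm_num
    have h7 : 2 * (β + 1) * ((4 : ℝ) ^ (β + 1) * 2 ^ β) * R ^ (2 - p) * (k ^ (p - 1) * δ) ≤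
        2 * (β + 1) * 8 ^ (β + 1) * R ^ (2 - p) * (k ^ (p - 1) * δ) := by gcongr
    have h8 : 0 ≤ (β + 1) * (8 : ℝ) ^ (β + 1) * R ^ (2 - p) * (k ^ (p - 1) * δ) := by positivity
    linarith

open Finset in
theorem card_nearSphere_le {N β : ℕ} (hβ : 1 ≤ β) : ∃ C : ℝ, 0 < C ∧ ∀ R δ : ℝ, 1 < R → 0 ≤ δ →
    δ < 1 → ∀ F : Finset (Fin (N + 1 + 1) → ℤ),
    (∀ m ∈ F, (R - δ) ^ (β + 1) ≤ intVecNorm (Fin.init m) ^ (β + 1) +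
        |(m (Fin.last _) : ℝ)| ^ (((β + 1 : ℕ) : ℝ) / 2) ∧
      intVecNorm (Fin.init m) ^ (β + 1) +
        |(m (Fin.last _) : ℝ)| ^ (((β + 1 : ℕ) : ℝ) / 2) ≤ (R + δ) ^ (β + 1)) →
    (#F : ℝ) ≤ C * (R ^ N * R ^ (2 - 2 / ((β + 1 : ℕ) : ℝ)) + R ^ (N + 2) * δ) := by
  classical
  have hβ' : (1 : ℝ) ≤ β := by exact_mod_cast hβ
  set q : ℝ := ((β + 1 : ℕ) : ℝ) with hq
  have hq' : q = β + 1 := by rw [hq]; push_cast; rfl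
  set p : ℝ := 2 / q with hp
  have hq0 : 0 < q := by linarith
  have hp0 : 0 < p := by positivity
  have hp1 : p ≤ 1 := by rw [hp, div_le_one hq0]; linarith
  set Cs : ℝ := (N + 1) * (32 * (N + 1) + 2) * 7 ^ N with hCs
  set C₁ : ℝ := 6 * (β + 1) * 8 ^ (β + 1) with hC₁
  have hCs0 : 0 < Cs := by positivity
  have hC₁0 : 0 < C₁ := by positivity
  refine ⟨Cs * (4 + 2 * C₁ + C₁ / p), by positivity, fun R δ hR hδ hδ1 F hF => ?_⟩
  have hR0 : 0 < R := by linarith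
  set w := shellWeight p δ with hw
  have hw0 : ∀ k, 0 ≤ w k := fun k => by rw [hw]; unfold shellWeight; split_ifs <;> positivity
  set h : ℕ → ℝ := fun k => 2 + C₁ * R ^ (2 - p) * w k with hh
  have hh0 : ∀ k, 0 ≤ h k := fun k => by have := hw0 k; positivity
  set Z := F.image (Fin.init (α := fun _ => ℤ)) with hZ
  have hZR : ∀ z ∈ Z, intVecNorm z ≤ R + 1 := by
    intro z hz
    obtain ⟨m, hm, rfl⟩ := mem_image.1 hz
    have h1 : 0 ≤ |(m (Fin.last _) : ℝ)| ^ (q / 2) := by positivity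
    have h2 : intVecNorm (Fin.init m) ≤ R + δ :=
      le_of_pow_le_pow_left₀ (Nat.succ_ne_zero β) (by linarith)
        ((le_add_of_nonneg_right h1).trans (hF m hm).2)
    linarith
  have hfib : ∀ z ∈ Z, (#{m ∈ F | Fin.init m = z} : ℝ) ≤ h ⌊R - intVecNorm z⌋₊ := by
    intro z _
    have hinj : Set.InjOn (fun m : Fin (N + 1 + 1) → ℤ => m (Fin.last _))
        ({m ∈ F | Fin.init m = z} : Finset _) := by
      intro m hm m' hm' hmm
      rw [← Fin.snoc_init_self m, ← Fin.snoc_init_self m', (mem_filter.1 hm).2,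
        (mem_filter.1 hm').2]
      exact congrArg _ hmm
    rw [← card_image_of_injOn hinj]
    refine card_vertical_fiber_le hβ hR hδ hδ1 (intVecNorm_nonneg z) _ fun t ht => ?_
    obtain ⟨m, hm, rfl⟩ := mem_image.1 ht
    obtain ⟨hm1, rfl⟩ := mem_filter.1 hm
    exact hF m hm1
  have hmaps : ∀ z ∈ Z, ⌊R - intVecNorm z⌋₊ ∈ range (⌊R⌋₊ + 1) := fun z _ =>
    mem_range.2 (Nat.lt_succ_of_le (Nat.floor_le_floor (by linarith [intVecNorm_nonneg z])))
  have hshell : ∀ k, (#{z ∈ Z | ⌊R - intVecNorm z⌋₊ = k} : ℝ) ≤ Cs * R ^ N := by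
    intro k
    -- Width 2 is needed only for `k = 0`: the truncated floor also sends the points with `R < |z| ≤
    -- R + 1` there.
    refine card_shell_le (r := R - k - 1) hR (by linarith [k.cast_nonneg (α := ℝ)]) _ fun z hz => ?_
    obtain ⟨hz1, rfl⟩ := mem_filter.1 hz
    refine ⟨by linarith [Nat.lt_floor_add_one (R - intVecNorm z)], ?_⟩
    rcases le_total 0 (R - intVecNorm z) with h0 | h0
    · linarith [Nat.floor_le h0]
    · rw [Nat.floor_of_nonpos h0]
      push_cast
      linarith [hZR z hz1]
  have hK : (⌊R⌋₊ : ℝ) ≤ R := Nat.floor_le hR0.le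
  have hsum : ∑ k ∈ range (⌊R⌋₊ + 1), h k ≤ 4 * R + C₁ * R ^ (2 - p) * (2 + R ^ p / p * δ) := by
    rw [hh, sum_add_distrib, ← mul_sum, sum_const, card_range, nsmul_eq_mul]
    have h1 : ∑ k ∈ range (⌊R⌋₊ + 1), w k ≤ 2 + R ^ p / p * δ :=
      (sum_shellWeight_le hp0 hp1 hδ _).trans (by gcongr)
    have h2 := mul_le_mul_of_nonneg_left h1 (by positivity : 0 ≤ C₁ * R ^ (2 - p))
    push_cast
    linarith
  have hRp : R ^ (2 - p) * R ^ p = R ^ 2 := by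
    rw [← Real.rpow_add hR0, sub_add_cancel, Real.rpow_ofNat]
  -- Absorbs the additive constant 2 of each fibre, which sums to `O(R)` over the shells.
  have hRle : R ≤ R ^ (2 - p) := by
    conv_lhs => rw [← Real.rpow_one R]
    exact Real.rpow_le_rpow_of_exponent_le hR.le (by linarith)
  calc (#F : ℝ) = ∑ z ∈ Z, (#{m ∈ F | Fin.init m = z} : ℝ) := by
        exact_mod_cast card_eq_sum_card_image (Fin.init (α := fun _ => ℤ)) F
    _ ≤ ∑ z ∈ Z, h ⌊R - intVecNorm z⌋₊ := sum_le_sum hfib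
    _ = ∑ k ∈ range (⌊R⌋₊ + 1), ∑ z ∈ Z with ⌊R - intVecNorm z⌋₊ = k, h ⌊R - intVecNorm z⌋₊ :=
        (sum_fiberwise_of_maps_to hmaps _).symm
    _ ≤ ∑ k ∈ range (⌊R⌋₊ + 1), Cs * R ^ N * h k := by
        refine sum_le_sum fun k _ => ?_
        rw [sum_congr rfl (g := fun _ => h k) fun z hz => by rw [(mem_filter.1 hz).2], sum_const,
          nsmul_eq_mul]
        exact mul_le_mul_of_nonneg_right (hshell k) (hh0 k)
    _ = Cs * R ^ N * ∑ k ∈ range (⌊R⌋₊ + 1), h k := by rw [mul_sum]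
    _ ≤ Cs * R ^ N * (4 * R ^ (2 - p) + C₁ * R ^ (2 - p) * (2 + R ^ p / p * δ)) := by
        gcongr
        linarith
    _ = Cs * ((4 + 2 * C₁) * (R ^ N * R ^ (2 - p)) +
        C₁ / p * (R ^ N * (R ^ (2 - p) * R ^ p) * δ)) := by ring
    _ = Cs * ((4 + 2 * C₁) * (R ^ N * R ^ (2 - p)) + C₁ / p * (R ^ (N + 2) * δ)) := by
        rw [hRp, ← pow_add]
    _ ≤ Cs * ((4 + 2 * C₁ + C₁ / p) * (R ^ N * R ^ (2 - p)) +
        (4 + 2 * C₁ + C₁ / p) * (R ^ (N + 2) * δ)) := by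
        have : 0 ≤ C₁ / p := by positivity
        refine mul_le_mul_of_nonneg_left (add_le_add ?_ ?_) hCs0.le <;>
          exact mul_le_mul_of_nonneg_right (by linarith) (by positivity)
    _ = _ := by ring

/-! ### From one sphere to pairs -/

/-- The lattice points within `δ` of the Heisenberg sphere of radius `R`. -/
def nearSphere (d : ℕ) (α R δ : ℝ) : Set (Fin (2 * d + 1) → ℤ) :=
  {m | |latticeHeisenbergNorm α m - R| ≤ δ}

theorem pow_bounds_of_mem_nearSphere {d α : ℕ} (hα : 0 < α) {R δ : ℝ} (hδR : δ < R)
    {m : Fin (2 * d + 1) → ℤ} (hm : m ∈ nearSphere d α R δ) :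
    (R - δ) ^ α ≤ intVecNorm (Fin.init m) ^ α + |(m (Fin.last _) : ℝ)| ^ ((α : ℝ) / 2) ∧
      intVecNorm (Fin.init m) ^ α + |(m (Fin.last _) : ℝ)| ^ ((α : ℝ) / 2) ≤ (R + δ) ^ α := by
  have hm' : |(intVecNorm (Fin.init m) ^ (α : ℝ) +
      |(m (Fin.last _) : ℝ)| ^ ((α : ℝ) / 2)) ^ (1 / (α : ℝ)) - R| ≤ δ := hm
  rw [Real.rpow_natCast] at hm'
  set X := intVecNorm (Fin.init m) ^ α + |(m (Fin.last _) : ℝ)| ^ ((α : ℝ) / 2)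
  have hX : 0 ≤ X := add_nonneg (pow_nonneg (intVecNorm_nonneg _) _) (by positivity)
  have hXα : (X ^ (1 / (α : ℝ))) ^ α = X := by
    rw [one_div]
    exact Real.rpow_inv_natCast_pow hX hα.ne'
  obtain ⟨h1, h2⟩ := abs_le.1 hm'
  rw [← hXα]
  exact ⟨pow_le_pow_left₀ (by linarith) (by linarith) _,
    pow_le_pow_left₀ (by positivity) (by linarith) _⟩

theorem finite_nearSphere {d α : ℕ} (hα : 0 < α) {R δ : ℝ} (hδR : δ < R) (hδ : 0 ≤ δ) :
    (nearSphere d α R δ).Finite := by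
  have hα' : (0 : ℝ) < α := by exact_mod_cast hα
  set M : ℝ := max (R + δ) (((R + δ) ^ α) ^ (2 / (α : ℝ))) with hM
  refine (Set.finite_Icc (fun _ => -⌊M⌋) (fun _ => ⌊M⌋)).subset fun m hm => ?_
  have h := (pow_bounds_of_mem_nearSphere hα hδR hm).2
  have h0 : 0 ≤ |(m (Fin.last _) : ℝ)| ^ ((α : ℝ) / 2) := by positivity
  have h1 : intVecNorm (Fin.init m) ≤ R + δ :=
    le_of_pow_le_pow_left₀ hα.ne' (by linarith) (by linarith)
  have h2 : |(m (Fin.last _) : ℝ)| ≤ ((R + δ) ^ α) ^ (2 / (α : ℝ)) := by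
    have e : |(m (Fin.last _) : ℝ)| = (|(m (Fin.last _) : ℝ)| ^ ((α : ℝ) / 2)) ^ (2 / (α : ℝ)) := by
      rw [← Real.rpow_mul (abs_nonneg _)]
      have : (α : ℝ) / 2 * (2 / α) = 1 := by field_simp
      rw [this, Real.rpow_one]
    rw [e]
    refine Real.rpow_le_rpow h0 ?_ (by positivity)
    have := pow_nonneg (intVecNorm_nonneg (Fin.init m)) α
    linarith
  have h3 : ∀ i, |m i| ≤ ⌊M⌋ := by
    intro i
    rw [Int.le_floor]
    push_cast
    induction i using Fin.lastCases with
    | last => exact h2.trans (le_max_right _ _)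
    | cast j =>
      exact (abs_coord_le_intVecNorm (Fin.init m) j).trans (h1.trans (le_max_left _ _))
  exact ⟨fun i => (abs_le.1 (h3 i)).1, fun i => (abs_le.1 (h3 i)).2⟩

theorem nearSpherePairs_eq_image (d : ℕ) (α R δ : ℝ) :
    nearSpherePairs d α R δ =
      (fun x : (Fin (2 * d + 1) → ℤ) × (Fin (2 * d + 1) → ℤ) => (x.1, x.1 - x.2)) ''
        (nearSphere d α R δ ×ˢ nearSphere d α R δ) := by
  ext ⟨m, p⟩
  constructor
  · rintro ⟨h1, h2⟩
    exact ⟨(m, m - p), ⟨h1, h2⟩, by simp⟩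
  · rintro ⟨⟨a, b⟩, ⟨h1, h2⟩, h⟩
    obtain ⟨rfl, rfl⟩ := Prod.mk.inj h
    refine ⟨h1, ?_⟩
    simpa [nearSphere] using h2

/-- For `α = 2` the quotient is `(n - 2) / n ≤ 1`. Otherwise `γ * α ≤ n - 1` and `2 * γ ≤ 1 ≤ n - 1`
give `γ * α ≤ 2 * (n - 1 - γ)`. -/
theorem gammaExponent_div_le {n α : ℕ} (hn : 3 ≤ n) (hα : 2 ≤ α) :
    gammaExponent n α / ((n : ℝ) - 1 - gammaExponent n α) ≤ 2 / (α : ℝ) := by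
  have hn' : (3 : ℝ) ≤ n := by exact_mod_cast hn
  have hα' : (2 : ℝ) ≤ α := by exact_mod_cast hα
  unfold gammaExponent
  split_ifs with h
  · subst h
    rw [div_le_div_iff₀ (by linarith) (by norm_num)]
    push_cast
    linarith
  · set g := min (((n : ℝ) - 1) / α) (1 / 2) with hg
    have h1 : g ≤ ((n : ℝ) - 1) / α := min_le_left _ _
    have h2 : g ≤ 1 / 2 := min_le_right _ _
    rw [le_div_iff₀ (by linarith)] at h1
    rw [div_le_div_iff₀ (by linarith) (by linarith)]
    nlinarith

theorem corollary1p2 (d α n : ℕ) (hd : 1 ≤ d) (hα : 2 ≤ α) (hn : n = 2 * d + 1) :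
    ∃ C : ℝ, 0 < C ∧ ∀ R δ : ℝ, 1 < R → 0 ≤ δ → δ < 1 →
      (nearSpherePairs d (α : ℝ) R δ).Finite ∧
      ((nearSpherePairs d (α : ℝ) R δ).ncard : ℝ) ≤
        C * max
          (R ^ (2 * ((n : ℝ) - gammaExponent n α / ((n : ℝ) - 1 - gammaExponent n α))))
          ((R ^ n * δ) ^ 2) := by
  obtain ⟨β, rfl⟩ : ∃ β, α = β + 1 := ⟨α - 1, by omega⟩
  obtain ⟨N, hN⟩ : ∃ N, 2 * d = N + 1 := ⟨2 * d - 1, by omega⟩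
  obtain ⟨C, hC, hcard⟩ := card_nearSphere_le (N := N) (β := β) (by omega)
  refine ⟨(2 * C) ^ 2, by positivity, fun R δ hR hδ hδ1 => ?_⟩
  have hR0 : 0 < R := by linarith
  have hfin := finite_nearSphere (d := d) (Nat.succ_pos β) (hδ1.trans hR) hδ
  set e := (n : ℝ) - gammaExponent n (β + 1) / ((n : ℝ) - 1 - gammaExponent n (β + 1)) with he
  have hnN : n = N + 2 := by omega
  have hcount : ((nearSphere d ((β + 1 : ℕ) : ℝ) R δ).ncard : ℝ) ≤
      2 * C * max (R ^ e) (R ^ n * δ) := by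
    have h1 : ((nearSphere d ((β + 1 : ℕ) : ℝ) R δ).ncard : ℝ) ≤
        C * (R ^ N * R ^ (2 - 2 / ((β + 1 : ℕ) : ℝ)) + R ^ (N + 2) * δ) := by
      rw [Set.ncard_eq_toFinset_card _ hfin]
      have hb : ∀ m ∈ hfin.toFinset, _ := fun m hm =>
        pow_bounds_of_mem_nearSphere (Nat.succ_pos β) (hδ1.trans hR) (hfin.mem_toFinset.1 hm)
      -- Abstracting the finset lets `2 * d` be rewritten to `N + 1` inside its type.
      generalize hfin.toFinset = F at hb ⊢
      clear hfin
      revert F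
      rw [hN]
      exact fun F hb => hcard R δ hR hδ hδ1 F hb
    have h2 : R ^ N * R ^ (2 - 2 / ((β + 1 : ℕ) : ℝ)) ≤ R ^ e := by
      rw [← Real.rpow_natCast, ← Real.rpow_add hR0]
      refine Real.rpow_le_rpow_of_exponent_le hR.le ?_
      have := gammaExponent_div_le (n := n) (α := β + 1) (by omega) hα
      have hc : (n : ℝ) = N + 2 := by rw [hnN]; push_cast; rfl
      linarith
    rw [← hnN] at h1
    calc _ ≤ _ := h1
      _ ≤ C * (max (R ^ e) (R ^ n * δ) + max (R ^ e) (R ^ n * δ)) := by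
        gcongr
        · exact h2.trans (le_max_left _ _)
        · exact le_max_right _ _
      _ = _ := by ring
  rw [nearSpherePairs_eq_image]
  refine ⟨(hfin.prod hfin).image _, ?_⟩
  have h3 : ((((fun x : (Fin (2 * d + 1) → ℤ) × (Fin (2 * d + 1) → ℤ) => (x.1, x.1 - x.2)) ''
        (nearSphere d ((β + 1 : ℕ) : ℝ) R δ ×ˢ nearSphere d ((β + 1 : ℕ) : ℝ) R δ)).ncard : ℕ) : ℝ) ≤
      ((nearSphere d ((β + 1 : ℕ) : ℝ) R δ).ncard : ℝ) ^ 2 := by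
    rw [sq, ← Nat.cast_mul, ← Set.ncard_prod]
    exact_mod_cast Set.ncard_image_le (hfin.prod hfin)
  refine h3.trans ((pow_le_pow_left₀ (Nat.cast_nonneg _) hcount 2).trans (le_of_eq ?_))
  have h4 : R ^ (2 * e) = (R ^ e) ^ 2 := by
    rw [mul_comm, Real.rpow_mul hR0.le, Real.rpow_ofNat]
  have ha : 0 ≤ R ^ e := by positivity
  have hb : 0 ≤ R ^ n * δ := by positivity
  rw [mul_pow, h4]
  congr 1
  rcases le_total (R ^ e) (R ^ n * δ) with h | h
  · rw [max_eq_right h, max_eq_right (pow_le_pow_left₀ ha h 2)]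
  · rw [max_eq_left h, max_eq_left (pow_le_pow_left₀ hb h 2)]
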